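/- Let $q=p^e\ge 5$ be an odd prime power ($p$ prime), and let $q-1=(N-1)s$ with integers $N\ge 3$, $s\ge 2$ and $p\nmid N$. Let $u,t,m\ge 1$ and $v\ge 0$ be integers with $v\le u$, $u+v\le\lfloor m/2\rfloor-1$ and $m\mid q-1$. Put $r=m-u$ and $\delta=u+1$. Then there is an optimal quantum $(r,\delta)$-LRC with parameters $$[[\,Ntm,\ Ntm-2Ntu-2v,\ u+v+1\,]]_q ,$$ induced by a Euclidean dual-containing matrix-product code $\mathcal C=[\mathcal C_1,\dots,\mathcal C_N]\cdot A$ with constituent linear codes $\mathcal C_i\subseteq\mathbb F_q^{tm}$ and an $N\times N$ defining matrix $A$ over $\mathbb F_q$ that is of type I $\tau$-optimal defining, where $\tau$ is the permutation of $\{1,\dots,N\}$ with $\tau(1)=1$, $\tau(N)=N$ and $\tau(i)=N+1-i$ for $1<i<N$. (As $t$, and the other parameters, vary, these codes form an infinite family.) Here the following definitions are used. * $[\mathcal C_1,\dots,\mathcal C_N]\cdot A$, with $A=(a_{i,j})$, consists of the words $(\sum_i a_{i,1}\mathbf c_i,\dots,\sum_i a_{i,N}\mathbf c_i)$ with $\mathbf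 c_i\in\mathcal C_i$. * $A$ is of type I $\tau$-optimal defining if, for every $1\le i\le N$, all $i\times i$ submatrices formed by the first $i$ rows and any $i$ columns are invertible, and the nonzero entries of $AA^{\top}$ are exactly those in the positions $(i,\tau(i))$. * A linear code $\mathcal C\subseteq\mathbb F_q^n$ is Euclidean dual-containing if $\mathcal C^{\perp}\subseteq\mathcal C$ for the Euclidean dual $\mathcal C^\perp$. It is an $(r,\delta)$-LRC if each coordinate $i$ lies in a set $S$ of at most $r+\delta-1$ coordinates such that the punctured code $\mathcal C|_{S}$ has minimum distance at least $\delta$. Its minimum distance is denoted by $d(\mathcal C)$. * An $[[n,k,d]]_q$ quantum code is a $q^k$-dimensional subspace of $(\mathbb C^q)^{\otimes n}$ that detects every error on fewer than $d$ qudits, but not every error on $d$ qudits. The quantum code induced by a dual-containing code $\mathcal C$ is the span of the vectors $\sum_{z\in x+\mathcal C^\perp}|z\rangle$, $x\in\mathcal C$. * The code $\mathcal C\subseteq\mathbb F_q^n$ induces an optimal quantum $(r,\delta)$-LRC with parameters $[[n,k,d]]_q$ if $\mathcal C$ is a Euclidean dual-containing $(r,\delta)$-LRC with $\dim\mathcal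 C=\frac{n+k}2$ and $d(\mathcal C)=d$, $\delta\le d(\mathcal C^\perp)$, the induced quantum code is an $[[n,k,d]]_q$ code, and $$k+2d+2\Big(\Big\lceil\frac{n+k}{2r}\Big\rceil-1\Big)(\delta-1)=n+2 .$$ -/

import Mathlib

namespace QuantumLRC

open Matrix

/-! ### Linear codes

A linear code of length `n` over `F` is a subspace of `ι → F`, where `ι` is a finite set of
`n` coordinates. -/

section Classical

variable {F ι : Type*} [Field F]

/-- The Euclidean dual: all `x` with `∑ x_i y_i = 0` for every `y ∈ C`. -/
def euclideanDual [Fintype ι] (C : Submodule F (ι → F)) : Submodule F (ι → F) where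
  carrier := {x | ∀ y ∈ C, x ⬝ᵥ y = 0}
  add_mem' := fun ha hb y hy => by rw [add_dotProduct, ha y hy, hb y hy, add_zero]
  zero_mem' := fun y _ => zero_dotProduct y
  smul_mem' := fun c x hx y hy => by rw [smul_dotProduct, hx y hy, smul_zero]

/-- `C^⊥ ⊆ C`. -/
def IsDualContaining [Fintype ι] (C : Submodule F (ι → F)) : Prop :=
  euclideanDual C ≤ C

/-- Every nonzero codeword has Hamming weight at least `d`. -/
def MinDistGE [Fintype ι] [DecidableEq F] (C : Submodule F (ι → F)) (d : ℕ) : Prop :=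
  ∀ c ∈ C, c ≠ 0 → d ≤ hammingNorm c

/-- The minimum distance of `C` (the least weight of a nonzero codeword) exists and equals `d`. -/
def HasMinDist [Fintype ι] [DecidableEq F] (C : Submodule F (ι → F)) (d : ℕ) : Prop :=
  IsLeast {w : ℕ | ∃ c ∈ C, c ≠ 0 ∧ hammingNorm c = w} d

/-- The punctured code `C|_S`: restrict every codeword to the coordinates in `S`. -/
def puncture (C : Submodule F (ι → F)) (S : Finset ι) : Submodule F (S → F) :=
  C.map (LinearMap.funLeft F F (fun i : S => (i : ι)))

/-- `C` is an `(r, δ)`-LRC: every coordinate `i` lies in a set `S` with `|S| ≤ r + δ - 1` such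
that the punctured code `C|_S` has minimum distance at least `δ`. -/
def IsLRC [DecidableEq F] (C : Submodule F (ι → F)) (r δ : ℕ) : Prop :=
  ∀ i : ι, ∃ S : Finset ι, i ∈ S ∧ S.card + 1 ≤ r + δ ∧ MinDistGE (puncture C S) δ

end Classical

/-! ### Matrix-product codes and their defining matrices -/

section MatrixProduct

variable {F ι : Type*} [Field F] {N M : ℕ}

/-- The matrix-product code `[C_1, …, C_N] · A`: all words whose `j`-th block (`j = 1, …, M`) is
`∑ i, A i j • c_i`, where `c_i ∈ C_i`. The coordinates are the pairs (block, position). -/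
def mpCode (C : Fin N → Submodule F (ι → F)) (A : Matrix (Fin N) (Fin M) F) :
    Submodule F (Fin M × ι → F) where
  carrier := {w | ∃ c : Fin N → ι → F, (∀ i, c i ∈ C i) ∧
    ∀ (j : Fin M) (l : ι), w (j, l) = ∑ i, A i j * c i l}
  add_mem' := by
    rintro a b ⟨c, hc, hca⟩ ⟨d, hd, hdb⟩
    refine ⟨fun i => c i + d i, fun i => (C i).add_mem (hc i) (hd i), fun j l => ?_⟩
    simp [hca, hdb, mul_add, Finset.sum_add_distrib]
  zero_mem' := ⟨fun _ => 0, fun i => (C i).zero_mem, fun j l => by simp⟩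
  smul_mem' := by
    rintro x a ⟨c, hc, hca⟩
    refine ⟨fun i => x • c i, fun i => (C i).smul_mem x (hc i), fun j l => ?_⟩
    simp [hca, Finset.mul_sum, mul_left_comm]

/-- Non-singular by columns: for every `i ≤ N`, every `i × i` submatrix formed by the first `i`
rows and some `i` columns `j_1 < ⋯ < j_i` is invertible. -/
def IsNSC (A : Matrix (Fin N) (Fin M) F) : Prop :=
  ∀ (i : ℕ) (hi : i ≤ N) (f : Fin i ↪o Fin M), (A.submatrix (Fin.castLE hi) f).det ≠ 0

/-- A `τ`-monomial matrix: the nonzero entries are exactly those in the positions `(i, τ i)`. -/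
def IsMonomial (τ : Equiv.Perm (Fin N)) (B : Matrix (Fin N) (Fin N) F) : Prop :=
  ∀ i j, B i j ≠ 0 ↔ j = τ i

/-- Type I `τ`-optimal defining matrices. -/
def IsTypeIOD (τ : Equiv.Perm (Fin N)) (A : Matrix (Fin N) (Fin N) F) : Prop :=
  IsNSC A ∧ IsMonomial τ (A * Aᵀ)

end MatrixProduct

/-! ### Quantum codes

The Hilbert space `(ℂ^q)^{⊗ n}` of `n` qudits is the space of functions `(ι → F) → ℂ`, with the
standard Hermitian inner product `⟨φ, ψ⟩ = star φ ⬝ᵥ ψ`; the computational basis of each qudit is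
labelled by the elements of `F`, `|F| = q`. A quantum code is a subspace. -/

section Quantum

variable {F ι : Type*} [Field F] [Fintype F] [Fintype ι]

open Classical in
/-- The operator that applies `e` to the qudits in `S` and is the identity on the others. -/
noncomputable def localOp (S : Finset ι) (e : Matrix (S → F) (S → F) ℂ) :
    Matrix (ι → F) (ι → F) ℂ :=
  fun x y => if ∀ i, i ∉ S → x i = y i then e (fun i => x i) (fun i => y i) else 0

open Classical in
/-- `Q` detects every error supported on `S` (the Knill-Laflamme condition): the compression of
each such error to `Q` is a scalar. -/
def Detects (Q : Submodule ℂ ((ι → F) → ℂ)) (S : Finset ι) : Prop :=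
  ∀ e : Matrix (S → F) (S → F) ℂ, ∃ c : ℂ, ∀ φ ∈ Q, ∀ ψ ∈ Q,
    star φ ⬝ᵥ (localOp S e *ᵥ ψ) = c * (star φ ⬝ᵥ ψ)

/-- `Q` is an `[[n, k, d]]_q` quantum code, where `q = |F|`: it has `n` qudits, dimension `q ^ k`
and minimum distance exactly `d`, i.e. it detects all errors on fewer than `d` qudits but not all
errors on `d` qudits. -/
structure IsQuantumCode (Q : Submodule ℂ ((ι → F) → ℂ)) (n k d : ℕ) : Prop where
  length : Fintype.card ι = n
  dimension : Module.finrank ℂ Q = Fintype.card F ^ k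
  distance : IsLeast {w : ℕ | ∃ S : Finset ι, S.card = w ∧ ¬ Detects Q S} d

/-- The quantum code induced by a Euclidean dual-containing code `C` (CSS construction): it is
spanned by the coset states `∑_{z ∈ x + C^⊥} |z⟩` with `x ∈ C`. -/
noncomputable def inducedCode (C : Submodule F (ι → F)) : Submodule ℂ ((ι → F) → ℂ) :=
  Submodule.span ℂ
    {ψ | ∃ x ∈ C, ψ = Set.indicator {z : ι → F | z - x ∈ euclideanDual C} (fun _ => (1 : ℂ))}

/-- The linear code `C` over `F`, `|F| = q`, induces an optimal quantum `(r, δ)`-LRC with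
parameters `[[n, k, d]]_q`. -/
structure InducesOptimalQuantumLRC [DecidableEq F] (C : Submodule F (ι → F))
    (r δ n k d : ℕ) : Prop where
  dualContaining : IsDualContaining C
  dim : 2 * Module.finrank F C = n + k
  lrc : IsLRC C r δ
  delta_le : MinDistGE (euclideanDual C) δ
  minDist : HasMinDist C d
  quantum : IsQuantumCode (inducedCode C) n k d
  optimal : (k : ℤ) + 2 * d + 2 * (⌈((n : ℚ) + k) / (2 * r)⌉ - 1) * ((δ : ℤ) - 1) = n + 2

end Quantum

end QuantumLRC

open QuantumLRC

/-! Cut `t * m` coordinates into `t` blocks, each carrying all `m`-th roots of unity `a`. Let `E`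
impose the checks `a ^ 1, …, a ^ u` on every block, and let `E' ≤ E` add the checks `a ^ (u + 1), …,
a ^ (u + v)` on all coordinates at once. The code is `[E, …, E, E'] · A`.

Inner products of checks are power sums of exponent between 2 and `2 * (u + v) < m`, so they vanish
and both codes contain their duals (`IsCyclicBlocks.isDualContaining`). Since `A * Aᵀ` is monomial
along a `τ` fixing the last index, the product code inherits this (`isDualContaining_mpCode`).

The rows of `A` are monic polynomials evaluated at 0 and the `(N-1)`-th roots of unity: Vandermonde
gives non-singularity by columns, power sums give `A * Aᵀ` (`exists_isTypeIOD`).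

By Vandermonde again, `E` has distance at least `u + 1` and `E'` at least `u + v + 1`. A product
word has at least the weight of its `E'` constituent, or at least twice that of a nonzero `E`
constituent, and `2 * (u + 1) > u + v + 1` (`mul_le_hammingNorm_mpCode`).

The quantum distance equals the classical one once a word of minimum weight lies outside the dual
(`isQuantumCode_inducedCode`); two codewords whose supports share one coordinate supply it
(`IsCyclicBlocks.exists_dotProduct_ne_zero`). -/

namespace QuantumLRC

open Matrix

/-! ### Euclidean duality -/

section Duality

variable {F ι : Type*} [Field F] [Fintype ι]

theorem mem_euclideanDual {C : Submodule F (ι → F)} {x : ι → F} :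
    x ∈ euclideanDual C ↔ ∀ y ∈ C, x ⬝ᵥ y = 0 := Iff.rfl

theorem euclideanDual_eq_orthogonal (C : Submodule F (ι → F)) :
    euclideanDual C = LinearMap.BilinForm.orthogonal (dotProductBilin F F) C := by
  ext x
  simp [mem_euclideanDual, LinearMap.BilinForm.mem_orthogonal_iff, dotProduct_comm x]

theorem dotProductBilin_isRefl :
    (dotProductBilin F F : LinearMap.BilinForm F (ι → F)).IsRefl := fun x y h => by
  simpa [dotProduct_comm] using h

theorem dotProductBilin_nondegenerate :
    (dotProductBilin F F : LinearMap.BilinForm F (ι → F)).Nondegenerate := by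
  classical
  rw [LinearMap.IsRefl.nondegenerate_iff_separatingLeft dotProductBilin_isRefl]
  intro x hx
  ext i
  simpa using hx (Pi.single i 1)

theorem euclideanDual_euclideanDual (C : Submodule F (ι → F)) :
    euclideanDual (euclideanDual C) = C := by
  simp only [euclideanDual_eq_orthogonal]
  exact LinearMap.BilinForm.orthogonal_orthogonal
    (B := (dotProductBilin F F : LinearMap.BilinForm F (ι → F))) dotProductBilin_nondegenerate
    dotProductBilin_isRefl C

theorem finrank_add_finrank_euclideanDual (C : Submodule F (ι → F)) :
    Module.finrank F C + Module.finrank F (euclideanDual C) = Fintype.card ι := by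
  rw [euclideanDual_eq_orthogonal,
    LinearMap.BilinForm.finrank_orthogonal dotProductBilin_nondegenerate,
    Module.finrank_fintype_fun_eq_card]
  have := Submodule.finrank_le C
  rw [Module.finrank_fintype_fun_eq_card] at this
  omega

end Duality

/-! ### Punctured codes -/

section Puncture

variable {F ι : Type*} [Field F] [DecidableEq F]

theorem minDistGE_puncture_iff {C : Submodule F (ι → F)} {S : Finset ι} {d : ℕ} :
    MinDistGE (puncture C S) d ↔
      ∀ c ∈ C, (∃ i ∈ S, c i ≠ 0) → d ≤ (S.filter fun i => c i ≠ 0).card := by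
  have key : ∀ c : ι → F, hammingNorm (LinearMap.funLeft F F (fun i : S => (i : ι)) c) =
      (S.filter fun i => c i ≠ 0).card := by
    intro c
    refine Finset.card_bij (fun i _ => (i : ι)) (fun i hi => ?_) (fun a _ b _ h => Subtype.ext h)
      fun i hi => ?_
    · exact Finset.mem_filter.2 ⟨i.2, (Finset.mem_filter.1 hi).2⟩
    · exact ⟨⟨i, (Finset.mem_filter.1 hi).1⟩,
        Finset.mem_filter.2 ⟨Finset.mem_univ _, (Finset.mem_filter.1 hi).2⟩, rfl⟩
  constructor
  · rintro h c hc ⟨i, hi, hci⟩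
    rw [← key]
    exact h _ (Submodule.mem_map_of_mem hc) fun h0 => hci (congrFun h0 ⟨i, hi⟩)
  · rintro h _ ⟨c, hc, rfl⟩ h0
    rw [key]
    refine h c hc ?_
    by_contra! hz
    exact h0 (funext fun i => hz i i.2)

end Puncture

/-! ### Matrix-product codes: weight, dimension, duality, locality -/

section MatrixProduct

variable {F ι : Type*} [Field F] {N M : ℕ}

theorem mem_mpCode {C : Fin N → Submodule F (ι → F)} {A : Matrix (Fin N) (Fin M) F}
    {w : Fin M × ι → F} : w ∈ mpCode C A ↔ ∃ c : Fin N → ι → F, (∀ i, c i ∈ C i) ∧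
      ∀ (j : Fin M) (l : ι), w (j, l) = ∑ i, A i j * c i l := Iff.rfl

theorem IsNSC.det_ne_zero {A : Matrix (Fin N) (Fin N) F} (hA : IsNSC A) : A.det ≠ 0 :=
  hA N le_rfl (OrderIso.refl _).toOrderEmbedding

/-- A nonzero combination of the first `k + 1` rows of a matrix that is non-singular by columns
has at most `k` zeros. -/
theorem IsNSC.card_zeros_le [DecidableEq F] {A : Matrix (Fin N) (Fin M) F} (hA : IsNSC A)
    {x : Fin N → F} {k : Fin N} (hk : x k ≠ 0) (hx : ∀ i, k < i → x i = 0) :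
    (Finset.univ.filter fun j => ∑ i, A i j * x i = 0).card ≤ k := by
  by_contra! hlt
  obtain ⟨Z, hZ, hcard⟩ := Finset.exists_subset_card_eq (Nat.succ_le_of_lt hlt)
  have hle : (k : ℕ) + 1 ≤ N := k.2
  have hdet := hA (k + 1) hle (Z.orderEmbOfFin hcard)
  -- With `k + 1` zeros, the first `k + 1` coefficients are annihilated by an invertible square
  -- submatrix.
  have h0 : (fun i : Fin (k + 1) => x (Fin.castLE hle i)) = 0 := by
    refine Matrix.eq_zero_of_vecMul_eq_zero hdet ?_
    ext j
    have hj := (Finset.mem_filter.1 (hZ (Z.orderEmbOfFin_mem hcard j))).2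
    rw [Pi.zero_apply, ← hj]
    simp only [vecMul, dotProduct, submatrix_apply]
    refine (Finset.sum_map Finset.univ (Fin.castLEEmb hle)
      (fun i => x i * A i (Z.orderEmbOfFin hcard j))).symm.trans ?_
    refine (Finset.sum_subset (Finset.subset_univ _) fun i _ hi => ?_).trans
      (Finset.sum_congr rfl fun i _ => mul_comm _ _)
    rw [hx i, zero_mul]
    by_contra hki
    refine hi (Finset.mem_map.2 ⟨⟨i, Nat.lt_succ_of_le (not_lt.1 hki)⟩, Finset.mem_univ _, ?_⟩)
    ext; simp
  exact hk (congrFun h0 (Fin.last k))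

/-- At each position `l` with `c k l ≠ 0`, the entries across the `M` blocks form a nonzero
combination of the first `k + 1` rows of `A`, hence have at most `k` zeros. -/
theorem mul_le_hammingNorm_mpCode [Fintype ι] [DecidableEq F] {A : Matrix (Fin N) (Fin M) F}
    (hA : IsNSC A) {c : Fin N → ι → F} {w : Fin M × ι → F}
    (hw : ∀ j l, w (j, l) = ∑ i, A i j * c i l) {k : Fin N} (hk : ∀ i, k < i → c i = 0) :
    (M - k) * hammingNorm (c k) ≤ hammingNorm w := by
  classical
  rw [hammingNorm, hammingNorm, mul_comm, ← smul_eq_mul, ← Finset.sum_const]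
  have hfib := Finset.card_eq_sum_card_fiberwise (f := Prod.snd)
    (s := Finset.univ.filter fun p => w p ≠ 0) (t := Finset.univ) (by simp)
  rw [hfib]
  refine (Finset.sum_le_sum fun l hl => ?_).trans
    (Finset.sum_le_sum_of_subset (Finset.subset_univ _))
  have hl' : c k l ≠ 0 := (Finset.mem_filter.1 hl).2
  have hz := hA.card_zeros_le (x := fun i => c i l) hl' fun i hi => by simp [hk i hi]
  have hsplit := Finset.card_filter_add_card_filter_not (s := (Finset.univ : Finset (Fin M)))
    (fun j => ∑ i, A i j * c i l = 0)
  have hcard : (Finset.univ.filter fun j => ¬ ∑ i, A i j * c i l = 0).card ≤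
      (((Finset.univ.filter fun p => w p ≠ 0)).filter fun p => p.2 = l).card := by
    refine Finset.card_le_card_of_injOn (fun j => (j, l)) ?_ fun a _ b _ h => by simpa using h
    intro j hj
    simpa [hw] using hj
  rw [Finset.card_univ, Fintype.card_fin] at hsplit
  omega

theorem finrank_mpCode [Finite ι] {A : Matrix (Fin N) (Fin N) F} (hA : A.det ≠ 0)
    (C : Fin N → Submodule F (ι → F)) :
    Module.finrank F (mpCode C A) = ∑ i, Module.finrank F (C i) := by
  let f : (∀ i, C i) →ₗ[F] (Fin N × ι → F) :=
    { toFun := fun c p => ∑ i, A i p.1 * (c i : ι → F) p.2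
      map_add' := fun a b => by ext p; simp [mul_add, Finset.sum_add_distrib]
      map_smul' := fun x a => by ext p; simp [Finset.mul_sum, mul_left_comm] }
  have hf : Function.Injective f := by
    rw [← LinearMap.ker_eq_bot, LinearMap.ker_eq_bot']
    intro c hc
    ext i l
    have : (fun i => (c i : ι → F) l) = 0 := by
      refine Matrix.eq_zero_of_vecMul_eq_zero hA ?_
      ext j
      simpa [f, vecMul, dotProduct, mul_comm] using congrFun hc (j, l)
    exact congrFun this i
  have hr : LinearMap.range f = mpCode C A := by
    ext w
    rw [mem_mpCode]
    constructor
    · rintro ⟨c, rfl⟩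
      exact ⟨fun i => c i, fun i => (c i).2, fun j l => rfl⟩
    · rintro ⟨c, hc, hw⟩
      exact ⟨fun i => ⟨c i, hc i⟩, funext fun p => (hw p.1 p.2).symm⟩
  have := Fintype.ofFinite ι
  rw [← hr, LinearMap.finrank_range_of_inj hf, Module.finrank_pi_fintype]

/-- If `c` lies in every constituent, then the word whose only nonzero block is `c` lies in the
matrix-product code. -/
theorem single_block_mem_mpCode {A : Matrix (Fin N) (Fin N) F} (hA : A.det ≠ 0)
    {C : Fin N → Submodule F (ι → F)} {c : ι → F} (hc : ∀ i, c ∈ C i) (j : Fin N) :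
    (fun p : Fin N × ι => if p.1 = j then c p.2 else 0) ∈ mpCode C A := by
  -- Row `j` of `A⁻¹ * A = 1` isolates block `j`.
  refine ⟨fun i => A⁻¹ j i • c, fun i => (C i).smul_mem _ (hc i), fun j' l => ?_⟩
  have h := congrFun (congrFun (Matrix.nonsing_inv_mul A (isUnit_iff_ne_zero.2 hA)) j) j'
  rw [Matrix.mul_apply, Matrix.one_apply] at h
  simp only [Pi.smul_apply, smul_eq_mul, mul_left_comm (A _ _), ← mul_assoc]
  rw [← Finset.sum_mul, h]
  simp [eq_comm]

/-- Write a dual word through its constituents `y`. Pairing it with the codeword whose only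
constituent is `c ∈ C (τ i)` leaves the single term `(A * Aᵀ) i (τ i) * (y i ⬝ᵥ c)`, so `y i` is
orthogonal to `C (τ i)`. -/
theorem isDualContaining_mpCode [Fintype ι] {A : Matrix (Fin N) (Fin N) F} {τ : Equiv.Perm (Fin N)}
    (hA : A.det ≠ 0) (hτ : IsMonomial τ (A * Aᵀ)) {C : Fin N → Submodule F (ι → F)}
    (hC : ∀ i, euclideanDual (C (τ i)) ≤ C i) : IsDualContaining (mpCode C A) := by
  intro w hw
  set y : Fin N → ι → F := fun i l => ∑ j, w (j, l) * A⁻¹ j i with hy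
  have hwy : ∀ j l, w (j, l) = ∑ i, A i j * y i l := by
    intro j l
    have h : (fun j => w (j, l)) ᵥ* (A⁻¹ * A) = fun j => w (j, l) := by
      rw [Matrix.nonsing_inv_mul A (isUnit_iff_ne_zero.2 hA), vecMul_one]
    rw [← vecMul_vecMul] at h
    rw [← congrFun h j]
    simp [vecMul, dotProduct, hy, mul_comm]
  refine ⟨y, fun i => hC i fun c hc => ?_, hwy⟩
  have hmem : (fun p : Fin N × ι => A (τ i) p.1 * c p.2) ∈ mpCode C A := by
    refine ⟨Pi.single (τ i) c, fun i' => ?_, fun j l => ?_⟩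
    · by_cases h : i' = τ i
      · subst h; simpa using hc
      · simp [h]
    · rw [Finset.sum_eq_single (τ i)]
      · simp
      · intro b _ hb; simp [hb]
      · simp
  have h0 := hw _ hmem
  have hsum : w ⬝ᵥ (fun p : Fin N × ι => A (τ i) p.1 * c p.2) =
      ∑ i', (A * Aᵀ) i' (τ i) * (y i' ⬝ᵥ c) := by
    simp only [dotProduct, Fintype.sum_prod_type, hwy, Matrix.mul_apply, transpose_apply,
      Finset.sum_mul, Finset.mul_sum]
    rw [Finset.sum_comm]
    simp_rw [Finset.sum_comm (s := (Finset.univ : Finset (Fin N)))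
      (t := (Finset.univ : Finset ι))]
    refine Finset.sum_congr rfl fun l _ => ?_
    rw [Finset.sum_comm]
    refine Finset.sum_congr rfl fun i' _ => Finset.sum_congr rfl fun j _ => ?_
    ring
  rw [hsum, Finset.sum_eq_single i] at h0
  · exact (mul_eq_zero.1 h0).resolve_left ((hτ i (τ i)).2 rfl)
  · intro b _ hb
    rw [not_not.1 (mt (hτ b (τ i)).1 fun h => hb (τ.injective h).symm), zero_mul]
  · simp

/-- Every block of a codeword lies in `E`, so repair sets of `E` can be copied into each block. -/
theorem IsLRC.mpCode [DecidableEq F] {E : Submodule F (ι → F)} {r δ : ℕ} (hE : IsLRC E r δ)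
    {C : Fin N → Submodule F (ι → F)} (hC : ∀ i, C i ≤ E) (A : Matrix (Fin N) (Fin M) F) :
    IsLRC (mpCode C A) r δ := by
  rintro ⟨j, l⟩
  obtain ⟨S, hl, hS, hd⟩ := hE l
  rw [minDistGE_puncture_iff] at hd
  refine ⟨S.map ⟨Prod.mk j, Prod.mk_right_injective j⟩, by simpa using hl, by simpa using hS, ?_⟩
  rw [minDistGE_puncture_iff]
  rintro w ⟨c, hc, hw⟩ ⟨p, hp, hwp⟩
  obtain ⟨l', hl', rfl⟩ := Finset.mem_map.1 hp
  have hmem : (fun l => w (j, l)) ∈ E := by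
    have : (fun l => w (j, l)) = ∑ i, A i j • c i := by ext l; simp [hw]
    rw [this]
    exact Submodule.sum_mem _ fun i _ => E.smul_mem _ (hC i (hc i))
  have := hd _ hmem ⟨l', hl', hwp⟩
  rwa [Finset.filter_map, Finset.card_map]

end MatrixProduct

/-! ### Coset states and the CSS construction -/

section CosetStates

variable {F ι : Type*} [Field F]

/-- The coset state `∑_{z ∈ x + D} |z⟩`. -/
noncomputable def cosetState (D : Submodule F (ι → F)) (x : ι → F) : (ι → F) → ℂ :=
  Set.indicator {z : ι → F | z - x ∈ D} fun _ => 1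

open Classical in
theorem cosetState_apply (D : Submodule F (ι → F)) (x z : ι → F) :
    cosetState D x z = if z - x ∈ D then 1 else 0 := by
  simp [cosetState, Set.indicator_apply]

theorem star_cosetState (D : Submodule F (ι → F)) (x : ι → F) :
    star (cosetState D x) = cosetState D x := by
  classical
  ext z
  rw [Pi.star_apply, cosetState_apply]
  split_ifs <;> simp

theorem cosetState_eq_of_sub_mem {D : Submodule F (ι → F)} {x y : ι → F} (h : y - x ∈ D) :
    cosetState D x = cosetState D y := by
  classical
  ext z
  rw [cosetState_apply, cosetState_apply, ← D.sub_mem_iff_left h, sub_sub_sub_cancel_right]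

end CosetStates

section LocalOp

variable {F ι : Type*} [Fintype ι]

open Classical in
theorem localOp_apply (S : Finset ι) (e : Matrix (S → F) (S → F) ℂ) (x y : ι → F) :
    localOp S e x y = if ∀ i, i ∉ S → x i = y i then e (fun i => x i) fun i => y i else 0 := rfl

end LocalOp

section CSS

variable {F ι : Type*} [Field F] [Fintype ι]

/-- If no nonzero word of `C` is supported on `S`, the dual of `C` projects onto `F^S`. -/
theorem exists_mem_euclideanDual_eqOn {C : Submodule F (ι → F)} {S : Finset ι}
    (hS : ∀ c ∈ C, (∀ i, i ∉ S → c i = 0) → c = 0) (x : ι → F) :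
    ∃ d ∈ euclideanDual C, ∀ i ∈ S, d i = x i := by
  classical
  -- A vector orthogonal to the punctured dual, extended by zero, lies in the double dual `C` and is
  -- supported on `S`.
  have hbot : euclideanDual (puncture (euclideanDual C) S) = ⊥ := by
    rw [eq_bot_iff]
    intro y hy
    let y' : ι → F := fun i => if h : i ∈ S then y ⟨i, h⟩ else 0
    have hy' : y' ∈ C := by
      rw [← euclideanDual_euclideanDual C]
      intro d hd
      have h := hy _ (Submodule.mem_map_of_mem hd)
      rw [← h, dotProduct, dotProduct, ← Finset.sum_subset (Finset.subset_univ S),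
        ← Finset.sum_coe_sort]
      · refine Finset.sum_congr rfl fun i _ => ?_
        simp [y', LinearMap.funLeft_apply]
      · intro i _ hi
        simp [y', hi]
    have h0 := hS y' hy' fun i hi => by simp [y', hi]
    rw [Submodule.mem_bot]
    ext i
    simpa [y'] using congrFun h0 i
  have htop : puncture (euclideanDual C) S = ⊤ := by
    rw [← euclideanDual_euclideanDual (puncture (euclideanDual C) S), hbot, eq_top_iff]
    intro y _ z hz
    rw [(Submodule.mem_bot F).1 hz, dotProduct_zero]
  obtain ⟨d, hd, hdx⟩ := htop.symm ▸ (Submodule.mem_top (x := fun i : S => x i))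
  exact ⟨d, hd, fun i hi => congrFun hdx ⟨i, hi⟩⟩

theorem inducedCode_eq_span (C : Submodule F (ι → F)) :
    inducedCode C = Submodule.span ℂ {ψ | ∃ x ∈ C, ψ = cosetState (euclideanDual C) x} := rfl

theorem cosetState_mem_inducedCode {C : Submodule F (ι → F)} {x : ι → F} (hx : x ∈ C) :
    cosetState (euclideanDual C) x ∈ inducedCode C :=
  Submodule.subset_span ⟨x, hx, rfl⟩

variable [Fintype F]

open Classical in
theorem cosetState_dotProduct_eq_zero {D : Submodule F (ι → F)} {x y : ι → F}
    (h : y - x ∉ D) : cosetState D x ⬝ᵥ cosetState D y = 0 := by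
  classical
  refine Finset.sum_eq_zero fun z _ => ?_
  rw [cosetState_apply, cosetState_apply]
  split_ifs with h1 h2 <;> try simp
  exact h (by simpa using D.sub_mem h1 h2)

open Classical in
theorem cosetState_dotProduct_self (D : Submodule F (ι → F)) (x : ι → F) :
    cosetState D x ⬝ᵥ cosetState D x = Nat.card D := by
  have : ∑ z, cosetState D x (z + x) * cosetState D x (z + x) = (Nat.card D : ℂ) := by
    simp [cosetState_apply, ← ite_and, Fintype.card_subtype]
  rw [← this]
  exact (Equiv.sum_comp (Equiv.addRight x) fun z => cosetState D x z * cosetState D x z).symm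

open Classical in
/-- An error supported where `C` has no nonzero word acts on coset states as a scalar. -/
theorem cosetState_dotProduct_localOp {C : Submodule F (ι → F)}
    (hC : IsDualContaining C)
    {S : Finset ι} (hS : ∀ c ∈ C, (∀ i, i ∉ S → c i = 0) → c = 0)
    (e : Matrix (S → F) (S → F) ℂ) {x y : ι → F} (hx : x ∈ C) (hy : y ∈ C) :
    cosetState (euclideanDual C) x ⬝ᵥ (localOp S e *ᵥ cosetState (euclideanDual C) y) =
      ((∑ z : ι → F, if z ∈ euclideanDual C then e (fun i => z i) (fun i => z i) else 0) /
        Nat.card (euclideanDual C)) *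
      (cosetState (euclideanDual C) x ⬝ᵥ cosetState (euclideanDual C) y) := by
  set D := euclideanDual C with hD
  -- a nonzero matrix entry between two words of `C` is diagonal
  have hdiag : ∀ z w, cosetState D x z * (localOp S e z w * cosetState D y w) ≠ 0 → z = w := by
    intro z w h
    rw [cosetState_apply, cosetState_apply] at h
    by_cases hz : z - x ∈ D
    swap
    · simp [hz] at h
    by_cases hw : w - y ∈ D
    swap
    · simp [hw] at h
    by_cases hzw : ∀ i, i ∉ S → z i = w i
    swap
    · simp [localOp, hzw] at h
    refine sub_eq_zero.1 (hS (z - w) ?_ fun i hi => by simp [hzw i hi])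
    have hz' : z ∈ C := by simpa using C.add_mem (hC hz) hx
    have hw' : w ∈ C := by simpa using C.add_mem (hC hw) hy
    exact C.sub_mem hz' hw'
  have hsum : cosetState D x ⬝ᵥ (localOp S e *ᵥ cosetState D y) =
      ∑ z, cosetState D x z * (localOp S e z z * cosetState D y z) := by
    simp only [dotProduct, mulVec, Finset.mul_sum]
    refine Finset.sum_congr rfl fun z _ => Finset.sum_eq_single z (fun w _ hw => ?_) (by simp)
    exact not_not.1 fun h => hw (hdiag z w h).symm
  by_cases hxy : y - x ∈ D
  -- The representative `x - d` of the same coset vanishes on `S`, so the diagonal entries of the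
  -- error do not depend on the coset.
  · obtain ⟨d, hd, hdx⟩ := exists_mem_euclideanDual_eqOn hS x
    have h1 : cosetState D x = cosetState D (x - d) :=
      cosetState_eq_of_sub_mem (by simpa using D.neg_mem hd)
    have h2 : cosetState D y = cosetState D x := (cosetState_eq_of_sub_mem hxy).symm
    rw [hsum, h2, cosetState_dotProduct_self, div_mul_cancel₀ _ (by simp), h1,
      ← Equiv.sum_comp (Equiv.addRight (x - d))]
    refine Finset.sum_congr rfl fun z _ => ?_
    simp only [Equiv.coe_addRight, cosetState_apply, add_sub_cancel_right]
    have hz : (fun i : S => (z + (x - d)) i) = fun i : S => z i := by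
      ext i
      simp [hdx i i.2]
    split_ifs with h
    · simp only [localOp, implies_true, if_true, hz, one_mul, mul_one]
    · simp
  · rw [cosetState_dotProduct_eq_zero hxy, mul_zero, hsum]
    have h0 := cosetState_dotProduct_eq_zero hxy
    refine Finset.sum_eq_zero fun z _ => ?_
    rw [cosetState_apply, cosetState_apply]
    split_ifs with h1 h2 <;> try simp
    exact (hxy (by simpa using D.sub_mem h1 h2)).elim

/-- The scalar found on coset states is the same for all pairs, so it passes to their span by
sesquilinearity. -/
theorem detects_inducedCode {C : Submodule F (ι → F)} (hC : IsDualContaining C)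
    {S : Finset ι} (hS : ∀ c ∈ C, (∀ i, i ∉ S → c i = 0) → c = 0) :
    Detects (inducedCode C) S := by
  classical
  intro e
  refine ⟨(∑ z : ι → F, if z ∈ euclideanDual C then e (fun i => z i) (fun i => z i) else 0) /
    Nat.card (euclideanDual C), fun φ hφ ψ hψ => ?_⟩
  · rw [inducedCode_eq_span] at hφ hψ
    induction hφ using Submodule.span_induction with
    | mem φ hφ =>
      obtain ⟨x, hx, rfl⟩ := hφ
      rw [star_cosetState]
      induction hψ using Submodule.span_induction with
      | mem ψ hψ =>
        obtain ⟨y, hy, rfl⟩ := hψ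
        exact cosetState_dotProduct_localOp hC hS e hx hy
      | zero => simp
      | add a b _ _ ha hb => rw [mulVec_add, dotProduct_add, ha, hb, dotProduct_add, mul_add]
      | smul r a _ ha =>
        rw [mulVec_smul, dotProduct_smul, ha, dotProduct_smul, smul_eq_mul, smul_eq_mul,
          mul_left_comm]
    | zero => simp
    | add a b _ _ ha hb => rw [star_add, add_dotProduct, ha, hb, add_dotProduct, mul_add]
    | smul r a _ ha =>
      rw [star_smul, smul_dotProduct, ha, smul_dotProduct, smul_eq_mul, smul_eq_mul,
        mul_left_comm]

theorem not_detects_inducedCode {C : Submodule F (ι → F)} {S : Finset ι} {c : ι → F} (hc : c ∈ C)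
    (hcD : c ∉ euclideanDual C) (hcS : ∀ i, i ∉ S → c i = 0) : ¬ Detects (inducedCode C) S := by
  classical
  intro h
  -- The undetected error is the shift by `c`: it maps the coset state of 0 to that of `c`, which is
  -- orthogonal to it but has nonzero norm.
  set e : Matrix (S → F) (S → F) ℂ :=
    Matrix.of fun a b => if a = fun i => b i + c i then 1 else 0 with he
  obtain ⟨r, hr⟩ := h e
  have h1 := hr _ (cosetState_mem_inducedCode hc) _ (cosetState_mem_inducedCode C.zero_mem)
  have hop : ∀ z w : ι → F, localOp S e z w = if w = z - c then 1 else 0 := by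
    intro z w
    rw [localOp_apply, he, Matrix.of_apply, ← ite_and]
    refine if_congr ⟨fun h => funext fun i => ?_, ?_⟩ rfl rfl
    · by_cases hi : i ∈ S
      · simpa using (sub_eq_of_eq_add (congrFun h.2 ⟨i, hi⟩)).symm
      · simp [h.1 i hi, hcS i hi]
    · rintro rfl
      exact ⟨fun i hi => by simp [hcS i hi], by ext i; simp⟩
  have h2 : localOp S e *ᵥ cosetState (euclideanDual C) 0 = cosetState (euclideanDual C) c := by
    ext z
    rw [mulVec, dotProduct, Finset.sum_eq_single (z - c)]
    · simp [hop, cosetState_apply]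
    · intro w _ hw
      rw [hop, if_neg hw, zero_mul]
    · simp
  rw [h2, star_cosetState, cosetState_dotProduct_self, cosetState_dotProduct_eq_zero,
    mul_zero] at h1
  · simp at h1
  · simpa using hcD

/-- Coset states of distinct classes in `C / C^⊥` have disjoint supports, so they form a basis, and
this quotient has dimension `k`. -/
theorem finrank_inducedCode {C : Submodule F (ι → F)} (hC : IsDualContaining C) {k : ℕ}
    (hk : 2 * Module.finrank F C = Fintype.card ι + k) :
    Module.finrank ℂ (inducedCode C) = Fintype.card F ^ k := by
  classical
  set D := euclideanDual C
  let D' : Submodule F C := D.comap C.subtype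
  let f : (C ⧸ D') → (ι → F) → ℂ := fun Q => cosetState D (Q.out : C)
  have hmk : ∀ a b : C, (Submodule.Quotient.mk a : C ⧸ D') = Submodule.Quotient.mk b ↔
      (a : ι → F) - b ∈ D := fun a b => by rw [Submodule.Quotient.eq]; rfl
  have hout : ∀ Q : C ⧸ D', (Submodule.Quotient.mk Q.out : C ⧸ D') = Q :=
    fun Q => Quotient.out_eq' Q
  have hspan : Submodule.span ℂ (Set.range f) = inducedCode C := by
    rw [inducedCode_eq_span]
    congr 1
    ext ψ
    constructor
    · rintro ⟨Q, rfl⟩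
      exact ⟨_, Q.out.2, rfl⟩
    · rintro ⟨x, hx, rfl⟩
      exact ⟨Submodule.Quotient.mk ⟨x, hx⟩,
        cosetState_eq_of_sub_mem ((hmk ⟨x, hx⟩ _).1 (hout _).symm)⟩
  have hli : LinearIndependent ℂ f := by
    rw [Fintype.linearIndependent_iff]
    intro a ha Q
    have h := congrFun ha (Q.out : C)
    rw [Finset.sum_apply, Finset.sum_eq_single Q] at h
    · simpa [f, cosetState_apply] using h
    · intro Q' _ hne
      have : ((Q.out : C) : ι → F) - (Q'.out : C) ∉ D := fun hmem =>
        hne (by rw [← hout Q, ← hout Q', (hmk _ _).2 hmem])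
      simp [f, cosetState_apply, this]
    · simp
  rw [← hspan, finrank_span_eq_card hli, Module.card_eq_pow_finrank (K := F)]
  congr 1
  have h1 := Submodule.finrank_quotient_add_finrank D'
  have h2 : Module.finrank F D' = Module.finrank F D :=
    (Submodule.comapSubtypeEquivOfLe hC).finrank_eq
  have h3 := finrank_add_finrank_euclideanDual C
  change _ + Module.finrank F D = _ at h3
  omega

/-- The CSS construction from a dual-containing code of minimum distance `d` that has a word of
weight `d` outside its dual. -/
theorem isQuantumCode_inducedCode [DecidableEq F] {C : Submodule F (ι → F)}
    (hC : IsDualContaining C) {k d : ℕ} (hk : 2 * Module.finrank F C = Fintype.card ι + k)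
    (hd : MinDistGE C d) {c : ι → F} (hc : c ∈ C) (hcD : c ∉ euclideanDual C)
    (hcd : hammingNorm c = d) : IsQuantumCode (inducedCode C) (Fintype.card ι) k d where
  length := rfl
  dimension := finrank_inducedCode hC hk
  distance := by
    refine ⟨⟨Finset.univ.filter fun i => c i ≠ 0, hcd,
      not_detects_inducedCode hc hcD fun i hi => by simpa using hi⟩, ?_⟩
    rintro _ ⟨S, rfl, hS⟩
    by_contra! hlt
    refine hS (detects_inducedCode hC fun x hx hxS => ?_)
    by_contra hne
    refine absurd (hd x hx hne) (not_le.2 (lt_of_le_of_lt (Finset.card_le_card fun i hi => ?_) hlt))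
    by_contra hiS
    exact (Finset.mem_filter.1 hi).2 (hxS i hiS)

end CSS

/-- Vandermonde applied to `x i * a i`; the extra factor is nonzero and can be cancelled. -/
theorem eq_zero_of_pow_sums {F ι : Type*} [Field F] {a : ι → F} {T : Finset ι}
    (hinj : Set.InjOn a T) (h0 : ∀ i ∈ T, a i ≠ 0)
    {w : ℕ} (hT : T.card ≤ w) {x : ι → F} (hx : ∀ j < w, ∑ i ∈ T, x i * a i ^ (j + 1) = 0) :
    ∀ i ∈ T, x i = 0 := by
  let f := T.equivFin
  have h : (fun k => x (f.symm k) * a (f.symm k)) = 0 := by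
    refine Matrix.eq_zero_of_forall_pow_sum_mul_pow_eq_zero (f := fun k => a (f.symm k)) ?_ ?_
    · intro k k' hk
      exact f.symm.injective (Subtype.ext (hinj (f.symm k).2 (f.symm k').2 hk))
    · intro k
      rw [← hx k (k.2.trans_le hT), ← Finset.sum_coe_sort T fun i => x i * a i ^ ((k : ℕ) + 1),
        ← Equiv.sum_comp f.symm fun i : T => x i * a i ^ ((k : ℕ) + 1)]
      refine Finset.sum_congr rfl fun l _ => ?_
      ring
  intro i hi
  have hi' := congrFun h (f ⟨i, hi⟩)
  simpa [h0 i hi] using hi'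

/-! ### The constituent codes -/

section BlockCodes

variable {F ι κ : Type*} [Field F] [Fintype ι] [DecidableEq κ]

/-- Evaluation points `a` on coordinates split by `blk` into blocks: in each block the points are
`m` distinct nonzero elements whose `j`-th power sums vanish for `0 < j < m`. -/
structure IsCyclicBlocks (blk : ι → κ) (a : ι → F) (m : ℕ) : Prop where
  ne_zero : ∀ i, a i ≠ 0
  inj : ∀ i i', blk i = blk i' → a i = a i' → i = i'
  card : ∀ b, (Finset.univ.filter fun i => blk i = b).card = m
  pow_sum : ∀ b j, 0 < j → j < m → ∑ i with blk i = b, a i ^ j = 0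

/-- The parity checks `a ^ (j + 1)`, `j < u`, on each block, and `a ^ (u + j + 1)`, `j < v`, on all
coordinates. -/
def blockParity (blk : ι → κ) (a : ι → F) (u v : ℕ) : (κ × Fin u) ⊕ Fin v → ι → F
  | Sum.inl (b, j) => fun i => if blk i = b then a i ^ ((j : ℕ) + 1) else 0
  | Sum.inr j => fun i => a i ^ (u + (j : ℕ) + 1)

/-- The code with parity checks `blockParity`. -/
def blockCode (blk : ι → κ) (a : ι → F) (u v : ℕ) : Submodule F (ι → F) :=
  euclideanDual (Submodule.span F (Set.range (blockParity blk a u v)))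

theorem mem_euclideanDual_span {s : Set (ι → F)} {x : ι → F} :
    x ∈ euclideanDual (Submodule.span F s) ↔ ∀ y ∈ s, x ⬝ᵥ y = 0 := by
  refine ⟨fun h y hy => h y (Submodule.subset_span hy), fun h y hy => ?_⟩
  induction hy using Submodule.span_induction with
  | mem y hy => exact h y hy
  | zero => simp
  | add y z _ _ hy hz => rw [dotProduct_add, hy, hz, add_zero]
  | smul r y _ hy => rw [dotProduct_smul, hy, smul_zero]

variable {blk : ι → κ} {a : ι → F} {m u v : ℕ}

theorem mem_blockCode_iff {x : ι → F} : x ∈ blockCode blk a u v ↔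
    (∀ b, ∀ j < u, ∑ i with blk i = b, x i * a i ^ (j + 1) = 0) ∧
      ∀ j < v, ∑ i, x i * a i ^ (u + j + 1) = 0 := by
  rw [blockCode, mem_euclideanDual_span, Set.forall_mem_range, Sum.forall, Prod.forall]
  simp only [blockParity, dotProduct, mul_ite, mul_zero, ← Finset.sum_filter, Fin.forall_iff]

theorem blockCode_le : blockCode blk a u v ≤ blockCode blk a u 0 := fun x hx => by
  rw [mem_blockCode_iff] at hx ⊢
  exact ⟨hx.1, by simp⟩

theorem IsCyclicBlocks.pow_sum_univ [Fintype κ] (h : IsCyclicBlocks blk a m) {j : ℕ} (hj : 0 < j)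
    (hjm : j < m) : ∑ i, a i ^ j = 0 := by
  rw [← Finset.sum_fiberwise Finset.univ blk]
  exact Finset.sum_eq_zero fun b _ => h.pow_sum b j hj hjm

/-- The inner product of two checks is 0 (different blocks) or a power sum of exponent from 2 to `2
* (u + v)`. Starting the exponents at 1 avoids the zeroth power sum, which need not vanish. -/
theorem IsCyclicBlocks.isDualContaining [Fintype κ] (h : IsCyclicBlocks blk a m)
    (hm : 2 * (u + v) < m) : IsDualContaining (blockCode blk a u v) := by
  rw [IsDualContaining, blockCode, euclideanDual_euclideanDual, Submodule.span_le]
  rintro _ ⟨p, rfl⟩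
  change blockParity blk a u v p ∈ blockCode blk a u v
  rw [mem_blockCode_iff]
  rcases p with ⟨b, j⟩ | j
  · refine ⟨fun b' j' hj' => ?_, fun j' hj' => ?_⟩
    · by_cases hb : b = b'
      · subst hb
        rw [← h.pow_sum b (j + 1 + (j' + 1)) (by omega) (by omega)]
        refine Finset.sum_congr rfl fun i hi => ?_
        simp [blockParity, (Finset.mem_filter.1 hi).2, ← pow_add]
      · refine Finset.sum_eq_zero fun i hi => ?_
        simp [blockParity, (Finset.mem_filter.1 hi).2, Ne.symm hb]
    · rw [← h.pow_sum b (j + 1 + (u + j' + 1)) (by omega) (by omega), Finset.sum_filter]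
      refine Finset.sum_congr rfl fun i _ => ?_
      simp [blockParity, ← pow_add]
  · refine ⟨fun b' j' hj' => ?_, fun j' hj' => ?_⟩
    · rw [← h.pow_sum b' (u + j + 1 + (j' + 1)) (by omega) (by omega)]
      refine Finset.sum_congr rfl fun i _ => ?_
      simp only [blockParity, ← pow_add]
    · rw [← h.pow_sum_univ (j := u + j + 1 + (u + j' + 1)) (by omega) (by omega)]
      refine Finset.sum_congr rfl fun i _ => ?_
      simp only [blockParity, ← pow_add]

theorem IsCyclicBlocks.linearIndependent_blockParity [Fintype κ] [Nonempty κ]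
    (h : IsCyclicBlocks blk a m) (hm : u + v ≤ m) :
    LinearIndependent F (blockParity blk a u v) := by
  rw [Fintype.linearIndependent_iff]
  intro g hg
  -- On block `b` only its own and the global checks survive; together they give coefficients for
  -- the exponents `1, …, u + v`, and `u + v` distinct nonzero points force them to vanish.
  have key : ∀ b, Fin.append (fun j => g (Sum.inl (b, j))) (fun j => g (Sum.inr j)) = 0 := by
    intro b
    obtain ⟨T, hT, hTcard⟩ := Finset.exists_subset_card_eq (hm.trans (h.card b).ge)
    let f := T.equivFinOfCardEq hTcard
    have hblk : ∀ k, blk (f.symm k) = b := fun k => (Finset.mem_filter.1 (hT (f.symm k).2)).2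
    refine Matrix.eq_zero_of_forall_index_sum_mul_pow_eq_zero (f := fun k => a (f.symm k)) ?_ ?_
    · intro k k' hk
      exact f.symm.injective (Subtype.ext (h.inj _ _ ((hblk k).trans (hblk k').symm) hk))
    · intro k
      have hk := congrFun hg (f.symm k)
      rw [Finset.sum_apply, Fintype.sum_sum_type, Fintype.sum_prod_type,
        Finset.sum_eq_single b] at hk
      · refine (mul_eq_zero_iff_right (h.ne_zero (f.symm k))).1 ?_
        rw [Pi.zero_apply] at hk
        rw [Fin.sum_univ_add, ← hk, add_mul, Finset.sum_mul, Finset.sum_mul]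
        simp [blockParity, hblk, pow_succ, mul_assoc]
      · intro b' _ hb'
        simp [blockParity, hblk, Ne.symm hb']
      · simp
  rintro (⟨b, j⟩ | j)
  · simpa using congrFun (key b) (Fin.castAdd v j)
  · simpa using congrFun (key (Classical.arbitrary κ)) (Fin.natAdd u j)

theorem IsCyclicBlocks.finrank_blockCode [Fintype κ] [Nonempty κ]
    (h : IsCyclicBlocks blk a m) (hm : u + v ≤ m) :
    Module.finrank F (blockCode blk a u v) + (Fintype.card κ * u + v) = Fintype.card ι := by
  have h1 := finrank_add_finrank_euclideanDual (blockCode blk a u v)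
  rwa [blockCode, euclideanDual_euclideanDual,
    finrank_span_eq_card (h.linearIndependent_blockParity hm), Fintype.card_sum, Fintype.card_prod,
    Fintype.card_fin, Fintype.card_fin] at h1

/-- A word of a block satisfying `w` parity checks, and nonzero there, has weight above `w`. -/
theorem IsCyclicBlocks.lt_card [DecidableEq F] (h : IsCyclicBlocks blk a m) {w : ℕ} {x : ι → F}
    {b : κ} (hx : ∀ j < w, ∑ i with blk i = b, x i * a i ^ (j + 1) = 0) {i₀ : ι}
    (hi₀ : blk i₀ = b) (hxi₀ : x i₀ ≠ 0) :
    w < (Finset.univ.filter fun i => blk i = b ∧ x i ≠ 0).card := by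
  by_contra! hle
  refine hxi₀ (eq_zero_of_pow_sums (a := a) ?_ (fun i _ => h.ne_zero i) hle (fun j hj => ?_) i₀
    (by simp [hi₀, hxi₀]))
  · intro i hi i' hi'
    simp only [Finset.coe_filter, Finset.mem_univ, true_and, Set.mem_ofPred_eq] at hi hi'
    exact h.inj i i' (hi.1.trans hi'.1.symm)
  · rw [← Finset.filter_filter]
    refine Eq.trans ?_ (hx j hj)
    refine Finset.sum_filter_of_ne fun i _ hne h0 => hne (mul_eq_zero_of_left h0 _)

/-- The repair set is the whole block, of size `m = (m - u) + (u + 1) - 1`. -/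
theorem IsCyclicBlocks.isLRC [DecidableEq F] (h : IsCyclicBlocks blk a m) (hum : u ≤ m) :
    IsLRC (blockCode blk a u v) (m - u) (u + 1) := by
  intro i
  refine ⟨Finset.univ.filter fun i' => blk i' = blk i, by simp, by rw [h.card]; omega, ?_⟩
  rw [minDistGE_puncture_iff]
  rintro c hc ⟨i₀, hi₀, hci₀⟩
  rw [Finset.filter_filter]
  exact h.lt_card ((mem_blockCode_iff.1 hc).1 _) (Finset.mem_filter.1 hi₀).2 hci₀

/-- For a word living in one block the global checks become checks on that block, `u + v` in total.
A word meeting two blocks has weight at least `2 * (u + 1)`, enough because `v ≤ u`. -/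
theorem IsCyclicBlocks.minDistGE [DecidableEq F] (h : IsCyclicBlocks blk a m) (hvu : v ≤ u) :
    MinDistGE (blockCode blk a u v) (u + v + 1) := by
  intro c hc hc0
  obtain ⟨i₀, hi₀⟩ := Function.ne_iff.1 hc0
  have hc' := mem_blockCode_iff.1 hc
  by_cases hone : ∀ i, c i ≠ 0 → blk i = blk i₀
  · refine (h.lt_card (w := u + v) (b := blk i₀) (fun j hj => ?_) rfl hi₀).trans_le
      (Finset.card_le_card fun i hi => ?_)
    · rcases lt_or_ge j u with hju | hju
      · exact hc'.1 _ j hju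
      · rw [← hc'.2 (j - u) (by omega), Nat.add_sub_cancel' hju]
        refine Finset.sum_filter_of_ne fun i _ hne => hone i fun h0 => hne ?_
        rw [h0, zero_mul]
    · exact Finset.mem_filter.2 ⟨Finset.mem_univ _, (Finset.mem_filter.1 hi).2.2⟩
  · classical
    push Not at hone
    obtain ⟨i₁, hi₁, hne⟩ := hone
    have h0 := h.lt_card (hc'.1 (blk i₀)) rfl hi₀
    have h1 := h.lt_card (hc'.1 (blk i₁)) rfl hi₁
    have hle := Finset.card_le_card (s := (Finset.univ.filter fun i => blk i = blk i₀ ∧ c i ≠ 0) ∪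
      (Finset.univ.filter fun i => blk i = blk i₁ ∧ c i ≠ 0))
      (t := Finset.univ.filter fun i => c i ≠ 0) (by
        intro i
        simp only [Finset.mem_union, Finset.mem_filter, Finset.mem_univ, true_and]
        tauto)
    rw [Finset.card_union_of_disjoint] at hle
    · change _ ≤ (Finset.univ.filter fun i => c i ≠ 0).card
      omega
    · rw [Finset.disjoint_left]
      intro i hi hi'
      exact hne ((Finset.mem_filter.1 hi').2.1.symm.trans (Finset.mem_filter.1 hi).2.1)

/-- Every set of `u + v + 1` coordinates of a block is the support of a codeword. -/
theorem IsCyclicBlocks.exists_mem_support_eq (h : IsCyclicBlocks blk a m) {b : κ} {T : Finset ι}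
    (hTb : ∀ i ∈ T, blk i = b) (hT : T.card = u + v + 1) :
    ∃ c ∈ blockCode blk a u v, ∀ i, c i ≠ 0 ↔ i ∈ T := by
  classical
  -- There are `u + v` equations in `u + v + 1` unknowns.
  let f : (T → F) →ₗ[F] (Fin (u + v) → F) := Matrix.mulVecLin
    (Matrix.of fun (j : Fin (u + v)) (i : T) => a i ^ ((j : ℕ) + 1))
  obtain ⟨y, hy, hy0⟩ := Submodule.exists_mem_ne_zero_of_ne_bot
    (LinearMap.ker_ne_bot_of_finrank_lt (f := f) (by simp [hT]))
  set x : ι → F := fun i => if hi : i ∈ T then y ⟨i, hi⟩ else 0 with hx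
  have hxT : ∀ i, i ∉ T → x i = 0 := fun i hi => by simp [hx, hi]
  have hsumT : ∀ j < u + v, ∑ i ∈ T, x i * a i ^ (j + 1) = 0 := by
    intro j hj
    rw [← Finset.sum_coe_sort T fun i => x i * a i ^ (j + 1)]
    refine Eq.trans ?_ (congrFun (LinearMap.mem_ker.1 hy) ⟨j, hj⟩)
    simp [f, mulVec, dotProduct, hx, mul_comm]
  have hblock : ∀ j < u + v, ∑ i with blk i = b, x i * a i ^ (j + 1) = 0 := by
    intro j hj
    rw [← hsumT j hj]
    refine (Finset.sum_subset (fun i hi => by simpa using hTb i hi) fun i _ hi => ?_).symm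
    rw [hxT i hi, zero_mul]
  have hsupp : ∀ i, x i ≠ 0 → i ∈ T := fun i hi => not_not.1 fun hiT => hi (hxT i hiT)
  refine ⟨x, mem_blockCode_iff.2 ⟨fun b' j hj => ?_, fun j hj => ?_⟩, fun i => ⟨hsupp i, ?_⟩⟩
  · by_cases hb : b' = b
    · rw [hb]
      exact hblock j (by omega)
    · refine Finset.sum_eq_zero fun i hi => ?_
      rw [hxT i fun hiT => hb ((Finset.mem_filter.1 hi).2.symm.trans (hTb i hiT)), zero_mul]
  · rw [← hsumT (u + j) (by omega)]
    refine (Finset.sum_subset (Finset.subset_univ T) fun i _ hi => ?_).symm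
    rw [hxT i hi, zero_mul]
  -- A zero inside `T` would leave weight at most `u + v`, against `IsCyclicBlocks.lt_card`.
  · intro hi hxi
    obtain ⟨i₀, hi₀⟩ := Function.ne_iff.1 hy0
    have hlt := h.lt_card hblock (hTb i₀ i₀.2) (by simpa [hx] using hi₀)
    have hsub : (Finset.univ.filter fun i => blk i = b ∧ x i ≠ 0) ⊆ T.erase i := by
      intro k hk
      have hk' := (Finset.mem_filter.1 hk).2.2
      exact Finset.mem_erase.2 ⟨fun hki => hk' (hki ▸ hxi), hsupp k hk'⟩
    have := Finset.card_le_card hsub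
    rw [Finset.card_erase_of_mem hi] at this
    omega

/-- Two supports of size `u + v + 1` meeting in exactly one coordinate fit into one block because `2
* (u + v) + 1 ≤ m`; the inner product then has a single nonzero term. -/
theorem IsCyclicBlocks.exists_dotProduct_ne_zero [DecidableEq F] [Nonempty κ]
    (h : IsCyclicBlocks blk a m) (hm : 2 * (u + v) < m) :
    ∃ c ∈ blockCode blk a u v, ∃ c' ∈ blockCode blk a u v,
      hammingNorm c = u + v + 1 ∧ c ⬝ᵥ c' ≠ 0 := by
  classical
  let b := Classical.arbitrary κ
  set B : Finset ι := Finset.univ.filter fun i => blk i = b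
  have hB : B.card = m := h.card b
  obtain ⟨T, hTB, hT⟩ := Finset.exists_subset_card_eq (s := B) (n := u + v + 1) (by omega)
  obtain ⟨i₀, hi₀⟩ := Finset.card_pos.1 (show 0 < T.card by omega)
  obtain ⟨U, hU, hUcard⟩ := Finset.exists_subset_card_eq (s := B \ T) (n := u + v)
    (by rw [Finset.card_sdiff_of_subset hTB]; omega)
  have hUT : ∀ i ∈ U, i ∉ T := fun i hi => (Finset.mem_sdiff.1 (hU hi)).2
  have hblk : ∀ i ∈ B, blk i = b := fun i hi => (Finset.mem_filter.1 hi).2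
  obtain ⟨c, hc, hcT⟩ := h.exists_mem_support_eq (u := u) (v := v)
    (fun i hi => hblk i (hTB hi)) hT
  obtain ⟨c', hc', hcT'⟩ := h.exists_mem_support_eq (u := u) (v := v) (b := b) (T := insert i₀ U)
    (by
      intro i hi
      rcases Finset.mem_insert.1 hi with rfl | hi
      · exact hblk _ (hTB hi₀)
      · exact hblk _ (Finset.mem_sdiff.1 (hU hi)).1)
    (by rw [Finset.card_insert_of_notMem fun hi => hUT i₀ hi hi₀, hUcard])
  refine ⟨c, hc, c', hc', ?_, ?_⟩
  · rw [← hT, hammingNorm]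
    congr 1
    ext i
    simpa using hcT i
  · rw [dotProduct, Finset.sum_eq_single i₀]
    · exact mul_ne_zero ((hcT i₀).2 hi₀) ((hcT' i₀).2 (Finset.mem_insert_self _ _))
    · intro i _ hne
      by_contra h0
      have h1 := (hcT i).1 (left_ne_zero_of_mul h0)
      have h2 := (hcT' i).1 (right_ne_zero_of_mul h0)
      exact hUT i ((Finset.mem_insert.1 h2).resolve_left hne) h1
    · simp

end BlockCodes

/-! ### The defining matrix -/

section DefiningMatrix

variable {F : Type*} [Field F] {n : ℕ}

/-- Monic polynomials of degrees `0, 1, …` evaluated at distinct points form a matrix that is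
non-singular by columns. -/
theorem isNSC_eval {P : ℕ → Polynomial F} (hdeg : ∀ i, (P i).natDegree = i)
    (hmonic : ∀ i, (P i).Monic) {N M : ℕ} {x : Fin M → F} (hx : Function.Injective x) :
    IsNSC (Matrix.of fun (i : Fin N) (j : Fin M) => (P i).eval (x j)) := by
  intro i hi f
  rw [← det_transpose]
  have h := det_eval_matrixOfPolynomials_eq_det_vandermonde (fun j : Fin i => x (f j))
    (fun k => P k) (fun k => hdeg k) fun k => hmonic k
  have h' : (vandermonde fun j : Fin i => x (f j)).det ≠ 0 :=
    det_vandermonde_ne_zero_iff.2 (hx.comp f.injective)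
  rw [h] at h'
  exact h'

/-- The power sums over `0` and the `n`-th roots of unity. -/
theorem sum_pow_snoc_zero {ω : F} (hω : IsPrimitiveRoot ω n) (k : ℕ) :
    ∑ j : Fin (n + 1), (Fin.snoc (α := fun _ => F) (fun j : Fin n => ω ^ (j : ℕ)) 0 j) ^ k =
      (if n ∣ k then (n : F) else 0) + if k = 0 then 1 else 0 := by
  rw [Fin.sum_univ_castSucc]
  -- The second summand is the contribution of the point 0, with `0 ^ 0 = 1`.
  simp only [Fin.snoc_castSucc, Fin.snoc_last, zero_pow_eq]
  congr 1
  rw [Fin.sum_univ_eq_sum_range fun j => (ω ^ j) ^ k]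
  simp_rw [pow_right_comm ω _ k]
  split_ifs with h
  · simp [(hω.pow_eq_one_iff_dvd k).2 h]
  · have h1 : ω ^ k ≠ 1 := mt (hω.pow_eq_one_iff_dvd k).1 h
    refine (mul_eq_zero_iff_left (sub_ne_zero.2 h1)).1 ?_
    rw [mul_geom_sum, pow_right_comm, hω.pow_eq_one, one_pow, sub_self]

theorem injective_snoc_zero {ω : F} (hω : IsPrimitiveRoot ω n) (hn : n ≠ 0) :
    Function.Injective (Fin.snoc (α := fun _ => F) (fun j : Fin n => ω ^ (j : ℕ)) 0) := by
  rw [Fin.snoc_injective_iff]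
  refine ⟨fun a b h => Fin.ext (hω.pow_inj a.2 b.2 h), ?_⟩
  rintro ⟨j, hj⟩
  exact pow_ne_zero _ (hω.ne_zero hn) hj

/-- The permutation of `{0, …, n}` that fixes `0` and `n` and reverses the others. -/
def revInterior (n : ℕ) : Equiv.Perm (Fin (n + 1)) :=
  Function.Involutive.toPerm (fun i => if i.val = 0 ∨ i.val = n then i else i.rev) (by
    intro i
    by_cases h : i.val = 0 ∨ i.val = n
    · simp only [if_pos h]
    · simp only [if_neg h]
      rw [if_neg (by rw [Fin.val_rev]; omega), Fin.rev_rev])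

theorem revInterior_apply (i : Fin (n + 1)) :
    revInterior n i = if i.val = 0 ∨ i.val = n then i else i.rev := rfl

theorem exists_isTypeIOD {ω : F} (hω : IsPrimitiveRoot ω n) (hn : 2 ≤ n) (hn0 : (n : F) ≠ 0)
    (hn1 : (n + 1 : F) ≠ 0) :
    ∃ A : Matrix (Fin (n + 1)) (Fin (n + 1)) F, IsTypeIOD (revInterior n) A := by
  -- For plain powers the product of rows `i` and `j` vanishes unless `n ∣ i + j`, which leaves the
  -- unwanted entries `(0, n)` and `(n, 0)`. Replacing `X ^ n` by `X ^ n - c` turns them into `n - c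
  -- * (n + 1) = 0`.
  set c : F := n / (n + 1) with hc
  let P : ℕ → Polynomial F := fun i =>
    Polynomial.X ^ i - Polynomial.C (if i = n then c else 0)
  set x : Fin (n + 1) → F := Fin.snoc (α := fun _ => F) (fun j : Fin n => ω ^ (j : ℕ)) 0 with hx
  have hsum := sum_pow_snoc_zero hω
  rw [← hx] at hsum
  have hdeg : ∀ i, (P i).natDegree = i := fun i => Polynomial.natDegree_X_pow_sub_C
  have hmonic : ∀ i, (P i).Monic := by
    intro i
    by_cases hi : i = 0
    · subst hi
      have : (0 : ℕ) ≠ n := by omega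
      simp [P, this]
    · exact Polynomial.monic_X_pow_sub_C _ hi
  refine ⟨_, isNSC_eval hdeg hmonic (injective_snoc_zero hω (by omega)), fun i j => ?_⟩
  rw [← hx, Matrix.mul_apply]
  simp only [Matrix.of_apply, transpose_apply, P, Polynomial.eval_sub, Polynomial.eval_pow,
    Polynomial.eval_X, Polynomial.eval_C]
  have hexp : ∀ (α β : F), ∑ k, (x k ^ (i : ℕ) - α) * (x k ^ (j : ℕ) - β) =
      ∑ k, x k ^ ((i : ℕ) + j) - β * ∑ k, x k ^ (i : ℕ) - α * ∑ k, x k ^ (j : ℕ)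
        + α * β * ∑ k, x k ^ 0 := by
    intro α β
    simp only [Finset.mul_sum, ← Finset.sum_sub_distrib, ← Finset.sum_add_distrib]
    refine Finset.sum_congr rfl fun k _ => ?_
    ring
  rw [hexp, hsum, hsum, hsum, hsum, revInterior_apply, Fin.ext_iff, apply_ite Fin.val, Fin.val_rev]
  have hcn : c * ((n : F) + 1) = n := div_mul_cancel₀ _ hn1
  have hc1 : (n : F) * (1 - c) ≠ 0 := by
    refine mul_ne_zero hn0 fun h => one_ne_zero (α := F) ?_
    linear_combination (n + 1 : F) * h + hcn
  obtain ⟨i, hi⟩ := i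
  obtain ⟨j, hj⟩ := j
  have hn' : n ≠ 0 := by omega
  have hdvd : ∀ k : ℕ, 0 < k → k < n → ¬ n ∣ k := fun k => Nat.not_dvd_of_pos_of_lt
  have hdvd' : ∀ k : ℕ, n < k → k < 2 * n → ¬ n ∣ k := fun k h1 h2 h => by
    obtain ⟨r, rfl⟩ := h
    have h3 : 1 < r := by by_contra! h; nlinarith
    nlinarith
  dsimp only
  rcases Nat.eq_zero_or_pos i with rfl | hi0
  · rcases Nat.eq_zero_or_pos j with rfl | hj0
    · simpa [hn', hn'.symm] using hn1
    · rcases eq_or_ne j n with rfl | hjn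
      · simp [hn', hn'.symm, hcn]
      · have := hdvd j hj0 (by omega)
        simp [hn'.symm, hjn, this, hj0.ne']
  · rcases eq_or_ne i n with rfl | hin
    · rcases Nat.eq_zero_or_pos j with rfl | hj0
      · simp [hn', hn'.symm, hcn]
      · rcases eq_or_ne j i with rfl | hji
        · have h1 : (j : F) - c * j - c * j + c * c * (j + 1) = j * (1 - c) := by
            linear_combination c * hcn
          have h2 : j ∣ j + j := ⟨2, by ring⟩
          simp only [h2, dvd_refl, if_true, dvd_zero, hn', add_zero, if_false,
            Nat.add_eq_zero_iff, and_self, h1, or_true]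
          simpa only [ne_eq, iff_true] using hc1
        · have h1 := hdvd j hj0 (by omega)
          simp [hji, h1, hj0.ne', hn']
    · rcases Nat.eq_zero_or_pos j with rfl | hj0
      · have := hdvd i hi0 (by omega)
        simp [hn'.symm, hin, this, hi0.ne']
        omega
      · rcases eq_or_ne j n with rfl | hjn
        · have := hdvd i hi0 (by omega)
          simp [hin, this, hi0.ne', hn']
          omega
        · have h1 := hdvd i hi0 (by omega)
          -- For interior indices `0 < i + j < 2 * n`, so the only possible multiple is `n`: this is
          -- the reversal in `τ`.
          have h2 : n ∣ i + j ↔ j = n - i := by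
            constructor
            · intro h
              rcases lt_trichotomy (i + j) n with h' | h' | h'
              · exact (hdvd _ (by omega) h' h).elim
              · omega
              · exact (hdvd' _ h' (by omega) h).elim
            · rintro rfl
              rw [Nat.add_sub_cancel' (by omega)]
          simp [hin, hjn, hi0.ne', h2, hn0]

end DefiningMatrix

/-! ### Assembly of the quantum LRC -/

section Construction

variable {F : Type*} [Field F]

theorem exists_isPrimitiveRoot_of_dvd [Fintype F] {m : ℕ} (hm : m ∣ Fintype.card F - 1) :
    ∃ ζ : F, IsPrimitiveRoot ζ m := by
  classical
  obtain ⟨g, hg⟩ := IsCyclic.exists_ofOrder_eq_natCard (α := Fˣ)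
  have hpos : 0 < Fintype.card F - 1 := Nat.sub_pos_of_lt Fintype.one_lt_card
  rw [Nat.card_eq_fintype_card, Fintype.card_units] at hg
  obtain ⟨r, hr⟩ := hm
  have h := ((IsPrimitiveRoot.orderOf g).map_of_injective (f := Units.coeHom F)
    Units.val_injective)
  rw [hg] at h
  exact ⟨_, h.pow hpos (hr.trans (mul_comm _ _))⟩

theorem isCyclicBlocks_of_isPrimitiveRoot {ζ : F} {t m : ℕ} (hζ : IsPrimitiveRoot ζ m)
    (hm : m ≠ 0) :
    IsCyclicBlocks (fun i : Fin (t * m) => (finProdFinEquiv.symm i).1)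
      (fun i => ζ ^ ((finProdFinEquiv.symm i).2 : ℕ)) m where
  ne_zero i := pow_ne_zero _ (hζ.ne_zero hm)
  inj i i' h h' := finProdFinEquiv.symm.injective
    (Prod.ext h (Fin.ext (hζ.pow_inj (Fin.is_lt _) (Fin.is_lt _) h')))
  card b := by
    rw [Finset.card_filter, ← Equiv.sum_comp finProdFinEquiv]
    simp only [Equiv.symm_apply_apply, Fintype.sum_prod_type]
    rw [Finset.sum_eq_single b (fun b' _ hb' => by simp [hb']) (by simp)]
    simp
  pow_sum b j hj hjm := by
    rw [Finset.sum_filter, ← Equiv.sum_comp finProdFinEquiv]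
    simp only [Equiv.symm_apply_apply, Fintype.sum_prod_type]
    rw [Finset.sum_eq_single b (fun b' _ hb' => by simp [hb']) (by simp)]
    simp only [if_true]
    rw [Fin.sum_univ_eq_sum_range fun k => (ζ ^ k) ^ j]
    simp_rw [pow_right_comm ζ _ j]
    have h1 : ζ ^ j ≠ 1 := hζ.pow_ne_one_of_pos_of_lt hj.ne' hjm
    refine (mul_eq_zero_iff_right (sub_ne_zero.2 h1)).1 ?_
    rw [geom_sum_mul, pow_right_comm, hζ.pow_eq_one, one_pow, sub_self]

/-- The matrix-product code of `n` copies of the locally `[m, m - u, u + 1]` code, followed by its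
subcode with `v` further global parity checks, induces an optimal quantum LRC. -/
theorem induces_optimal_mpCode [Fintype F] [DecidableEq F] {ι κ : Type*} [Fintype ι] [Fintype κ]
    [DecidableEq κ] [Nonempty κ] {blk : ι → κ} {a : ι → F} {m u v n k : ℕ}
    (h : IsCyclicBlocks blk a m) (hvu : v ≤ u) (hm : 2 * (u + v) < m)
    {τ : Equiv.Perm (Fin (n + 1))} (hτ : τ (Fin.last n) = Fin.last n)
    {A : Matrix (Fin (n + 1)) (Fin (n + 1)) F} (hA : IsTypeIOD τ A)
    (hk : k + 2 * ((n + 1) * Fintype.card κ * u + v) = (n + 1) * Fintype.card κ * m) :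
    InducesOptimalQuantumLRC
      (mpCode (fun i => if i = Fin.last n then blockCode blk a u v else blockCode blk a u 0) A)
      (m - u) (u + 1) ((n + 1) * Fintype.card κ * m) k (u + v + 1) := by
  set C : Fin (n + 1) → Submodule F (ι → F) :=
    fun i => if i = Fin.last n then blockCode blk a u v else blockCode blk a u 0 with hC
  have hdet := hA.1.det_ne_zero
  have hι : Fintype.card ι = Fintype.card κ * m := by
    rw [← Finset.card_univ,
      Finset.card_eq_sum_card_fiberwise (f := blk) (t := Finset.univ) (by simp)]
    simp [h.card]
  have hcard : Fintype.card (Fin (n + 1) × ι) = (n + 1) * Fintype.card κ * m := by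
    rw [Fintype.card_prod, Fintype.card_fin, hι, mul_assoc]
  have hCle : ∀ i, C i ≤ blockCode blk a u 0 := by
    intro i
    simp only [hC]
    split_ifs
    exacts [blockCode_le, le_rfl]
  have hCge : ∀ i, blockCode blk a u v ≤ C i := by
    intro i
    simp only [hC]
    split_ifs
    exacts [le_rfl, blockCode_le]
  have hdual : IsDualContaining (mpCode C A) := by
    refine isDualContaining_mpCode hdet hA.2 fun i => ?_
    by_cases hi : i = Fin.last n
    · simp only [hC, hi, hτ, if_true]
      exact h.isDualContaining hm
    -- As `τ` fixes the last index, `C (τ i) = C i`, and each constituent need only contain its own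
    -- dual.
    · have hτi : τ i ≠ Fin.last n := fun h' => hi (τ.injective (h'.trans hτ.symm))
      simp only [hC, hi, hτi, if_false]
      exact h.isDualContaining (by omega)
  have hdim : 2 * Module.finrank F (mpCode C A) = (n + 1) * Fintype.card κ * m + k := by
    rw [finrank_mpCode hdet, Fin.sum_univ_castSucc]
    have h1 := h.finrank_blockCode (u := u) (v := v) (by omega)
    have h2 := h.finrank_blockCode (u := u) (v := 0) (by omega)
    have hlast : C (Fin.last n) = blockCode blk a u v := if_pos rfl
    have hcs : ∀ i : Fin n, C i.castSucc = blockCode blk a u 0 := fun i =>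
      if_neg (Fin.castSucc_ne_last i)
    rw [hlast, Finset.sum_congr rfl fun i _ =>
        congrArg (fun D : Submodule F (ι → F) => Module.finrank F D) (hcs i),
      Finset.sum_const, Finset.card_univ, Fintype.card_fin, smul_eq_mul]
    rw [hι] at h1 h2
    generalize Module.finrank F (blockCode blk a u v) = d1 at *
    generalize Module.finrank F (blockCode blk a u 0) = d2 at *
    zify at *
    linear_combination 2 * h1 + 2 * (n : ℤ) * h2 - hk
  have hmin : MinDistGE (mpCode C A) (u + v + 1) := by
    rintro w ⟨c, hc, hw⟩ hw0
    by_cases hlast : c (Fin.last n) = 0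
    · have hne : (Finset.univ.filter fun i => c i ≠ 0).Nonempty := by
        by_contra hempty
        rw [Finset.not_nonempty_iff_eq_empty, Finset.filter_eq_empty_iff] at hempty
        refine hw0 (funext fun p => ?_)
        rw [hw p.1 p.2]
        refine Finset.sum_eq_zero fun i _ => ?_
        simp [not_not.1 (hempty (Finset.mem_univ i))]
      obtain ⟨i₀, hi₀, hmax⟩ := Finset.exists_max_image _ id hne
      have hci₀ := (Finset.mem_filter.1 hi₀).2
      have hle := mul_le_hammingNorm_mpCode hA.1 hw (k := i₀) fun i hi => by
        by_contra hci
        exact absurd (hmax i (Finset.mem_filter.2 ⟨Finset.mem_univ _, hci⟩)) hi.not_ge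
      have hwt := (h.minDistGE (v := 0) (Nat.zero_le u)) _ (hCle i₀ (hc i₀)) hci₀
      have hlt : (i₀ : ℕ) < n := Fin.val_lt_last fun h' => hci₀ (h' ▸ hlast)
      -- The last nonzero constituent is not the final one, so its weight, at least `u + 1`, counts
      -- at least twice.
      have h2 : 2 ≤ n + 1 - (i₀ : ℕ) := by omega
      have := Nat.mul_le_mul h2 hwt
      omega
    · refine ((h.minDistGE hvu) _ (by simpa [hC] using hc (Fin.last n)) hlast).trans ?_
      have := mul_le_hammingNorm_mpCode hA.1 hw (k := Fin.last n)
        fun i hi => absurd hi (Fin.le_last i).not_gt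
      simpa using this
  obtain ⟨c, hc, c', hc', hcw, hcc⟩ := h.exists_dotProduct_ne_zero hm
  set w : Fin (n + 1) × ι → F := fun p => if p.1 = 0 then c p.2 else 0 with hw
  set w' : Fin (n + 1) × ι → F := fun p => if p.1 = 0 then c' p.2 else 0 with hw'
  have hwC : w ∈ mpCode C A := single_block_mem_mpCode hdet (fun i => hCge i hc) 0
  have hwC' : w' ∈ mpCode C A := single_block_mem_mpCode hdet (fun i => hCge i hc') 0
  have hwnorm : hammingNorm w = u + v + 1 := by
    rw [← hcw, hammingNorm, hammingNorm, Finset.card_filter, Finset.card_filter,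
      Fintype.sum_prod_type, Finset.sum_eq_single (0 : Fin (n + 1))]
    · simp [hw]
    · intro j _ hj
      simp [hw, hj]
    · simp
  have hwdual : w ∉ euclideanDual (mpCode C A) := by
    intro hmem
    refine hcc ((?_ : _ = w ⬝ᵥ w').trans (hmem w' hwC'))
    rw [dotProduct, dotProduct, Fintype.sum_prod_type, Finset.sum_eq_single (0 : Fin (n + 1))]
    · simp [hw, hw']
    · intro j _ hj
      simp [hw, hj]
    · simp
  have hw0 : w ≠ 0 := fun h0 => by simp [h0] at hwnorm
  refine ⟨hdual, hdim, (h.isLRC (by omega)).mpCode hCle A,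
    fun x hx hx0 => le_trans (by omega) (hmin x (hdual hx) hx0),
    ⟨⟨w, hwC, hw0, hwnorm⟩, ?_⟩, ?_, ?_⟩
  · rintro _ ⟨x, hx, hx0, rfl⟩
    exact hmin x hx hx0
  · rw [← hcard]
    exact isQuantumCode_inducedCode hdual (by rw [hdim, hcard]) hmin hwC hwdual hwnorm
  · have hr : (0 : ℚ) < m - u := by
      rw [sub_pos]
      exact_mod_cast (by omega : u < m)
    have hvr : (v : ℚ) < m - u := by
      rw [lt_sub_iff_add_lt]
      exact_mod_cast (by omega : v + u < m)
    have hkQ : (k : ℚ) + 2 * ((n + 1) * Fintype.card κ * u + v) = (n + 1) * Fintype.card κ * m := by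
      exact_mod_cast hk
    -- Half the numerator is `(n + 1) * card κ * (m - u) - v` with `0 ≤ v < m - u`, so the quotient
    -- rounds up to the number of local blocks.
    have hceil : ⌈((((n + 1) * Fintype.card κ * m : ℕ) : ℚ) + k) / (2 * ((m - u : ℕ) : ℚ))⌉ =
        (n + 1) * Fintype.card κ := by
      rw [Int.ceil_eq_iff, Nat.cast_sub (by omega), lt_div_iff₀ (by linarith),
        div_le_iff₀ (by linarith)]
      push_cast
      constructor <;> nlinarith
    rw [hceil]
    push_cast
    have hkZ : (k : ℤ) + 2 * ((n + 1) * Fintype.card κ * u + v) = (n + 1) * Fintype.card κ * m := by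
      exact_mod_cast hk
    linear_combination hkZ

end Construction

end QuantumLRC

theorem theorem13 {F : Type*} [Field F] [Fintype F] [DecidableEq F]
    (p e q N s u t m v : ℕ)
    (hp : p.Prime) (hq : q = p ^ e) (hq_odd : Odd q) (hq5 : 5 ≤ q)
    (hF : Fintype.card F = q)
    (hN : 3 ≤ N) (hs : 2 ≤ s) (hqN : q - 1 = (N - 1) * s) (hpN : ¬ p ∣ N)
    (hu : 1 ≤ u) (ht : 1 ≤ t) (hm : 1 ≤ m) (hvu : v ≤ u)
    (huv : (u : ℤ) + v ≤ ((m / 2 : ℕ) : ℤ) - 1) (hmq : m ∣ q - 1) :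
    ∃ (τ : Equiv.Perm (Fin N)) (A : Matrix (Fin N) (Fin N) F)
      (C : Fin N → Submodule F (Fin (t * m) → F)) (k : ℕ),
      -- `τ` fixes the first and the last index and reverses the order of the others
      (∀ i : Fin N, τ i = if i.val = 0 ∨ i.val + 1 = N then i else i.rev) ∧
      IsTypeIOD τ A ∧
      (k : ℤ) = N * t * m - 2 * N * t * u - 2 * v ∧
      InducesOptimalQuantumLRC (mpCode C A) (m - u) (u + 1) (N * t * m) k (u + v + 1) := by
  obtain ⟨n, rfl⟩ : ∃ n, N = n + 1 := ⟨N - 1, by omega⟩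
  rw [Nat.add_sub_cancel] at hqN
  have hqF : (q : F) = 0 := by rw [← hF]; exact Nat.cast_card_eq_zero F
  have := Fact.mk hp
  have hchar : CharP F p := charP_of_card_eq_prime_pow (hF.trans hq)
  have hn1 : (n + 1 : F) ≠ 0 := by
    rw [← Nat.cast_succ, Ne, CharP.cast_eq_zero_iff F p]
    exact hpN
  -- In `F` one has `n * s = q - 1 = -1`.
  have hn0 : (n : F) ≠ 0 := by
    intro h0
    have h1 : ((q - 1 : ℕ) : F) = 0 := by rw [hqN, Nat.cast_mul, h0, zero_mul]
    rw [Nat.cast_sub (by omega), hqF] at h1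
    simp at h1
  obtain ⟨ω, hω⟩ := exists_isPrimitiveRoot_of_dvd (F := F) (m := n)
    (by rw [hF, hqN]; exact dvd_mul_right _ _)
  obtain ⟨ζ, hζ⟩ := exists_isPrimitiveRoot_of_dvd (F := F) (m := m) (by rwa [hF])
  obtain ⟨A, hA⟩ := exists_isTypeIOD hω (by omega) hn0 hn1
  have hblocks := isCyclicBlocks_of_isPrimitiveRoot (t := t) hζ (by omega)
  have : Nonempty (Fin t) := ⟨⟨0, ht⟩⟩
  -- This makes the truncated subtraction defining `k` exact.
  have hle : 2 * ((n + 1) * t * u + v) ≤ (n + 1) * t * m := by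
    have h1 : 2 * (u + v) ≤ m := by omega
    have h2 : 1 ≤ (n + 1) * t := Nat.mul_pos (Nat.succ_pos n) ht
    nlinarith
  have hk : (n + 1) * t * m - 2 * ((n + 1) * t * u + v) +
      2 * ((n + 1) * Fintype.card (Fin t) * u + v) = (n + 1) * Fintype.card (Fin t) * m := by
    rw [Fintype.card_fin]
    exact Nat.sub_add_cancel hle
  have hmain := induces_optimal_mpCode hblocks hvu (by omega) (by simp [revInterior_apply]) hA hk
  rw [Fintype.card_fin] at hmain
  refine ⟨revInterior n, A, _, _, fun i => ?_, hA, ?_, hmain⟩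
  · rw [revInterior_apply]
    simp
  · rw [Nat.cast_sub hle]
    push_cast
    ring
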